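/- Let $H_1,H_2$ be Hilbert spaces, both real or both complex, and let $\mathbf H=H_1\otimes H_2$ be their Hilbert space tensor product, with inner product induced by $\langle u_1\otimes v_1,u_2\otimes v_2\rangle=\langle u_1,u_2\rangle\langle v_1,v_2\rangle$. Every $\mathbf u\in\mathbf H$ has a singular value decomposition $\mathbf u=\sum_{k\ge1}\sigma_k\,u_k\otimes v_k$ with $\sigma_1\ge\sigma_2\ge\dots\ge0$ and orthonormal singular vectors $u_k$ and $v_k$; its rank is the smallest $r\ge 0$ with $\sigma_{r+1}=0$, and $\infty$ if there is none. For $r\in\mathbb N$ let $$\tau_r(\mathbf u)=\inf\Big\{\Big\|\mathbf u-\sum_{k=1}^r\tilde u_k\otimes\tilde v_k\Big\| : \tilde u_k\in H_1,\ \tilde v_k\in H_2\Big\}.$$ Let $\mathbf u\in\mathbf H$, let $\Phi:\mathbf H\to\mathbf H$ be a map, and let $c>0$, $0<q<1$ and $R>1$ be real numbers. Let $\mathcal D\subseteq\mathbf H$ be a set such that for every $\mathbf u_0\in\mathcal D$ the sequence $\mathbf u_{n+1}=\Phi(\mathbf u_n)$ satisfies, for all $n\ge0$, (A1) $\|\mathbf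 u_{n+1}-\mathbf u\|\le c\,q^{n+1}\|\mathbf u_0-\mathbf u\|$, (A2) $\operatorname{rank}(\mathbf u_{n+1})\le R\cdot\operatorname{rank}(\mathbf u_n)$, and assume (A0) $\mathcal D$ contains an element of rank at most one. Put $\pi_1(\mathbf u)=\inf\{\|\mathbf v-\mathbf u\| : \mathbf v\in\mathcal D,\ \operatorname{rank}(\mathbf v)\le1\}$. Then for every integer $r\ge1$ such that $c\ge1$ or $r\ge R$, $$\tau_r(\mathbf u)\le c\,\pi_1(\mathbf u)\sqrt{1-\frac{(1-q^2)\,(r-R^{\lfloor\log_R r\rfloor})}{(R-1)\,R^{\lfloor\log_R r\rfloor}}}\;q^{\lfloor\log_R r\rfloor},$$ and moreover $$\tau_r(\mathbf u)\le c\,\pi_1(\mathbf u)\,q^{\lfloor\log_R r\rfloor}\le c\,\pi_1(\mathbf u)\,q^{(\log_R r)-1}=c\,\pi_1(\mathbf u)\,q^{-1}\Big(\frac1r\Big)^{\left|\frac{\ln q}{\ln R}\right|}.$$ -/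

import Mathlib

open scoped TensorProduct

noncomputable section

/-- The Hilbert space tensor product `H₁ ⊗ H₂`: the completion of the algebraic tensor product
with respect to the induced inner product `⟪a ⊗ b, a' ⊗ b'⟫ = ⟪a, a'⟫ * ⟪b, b'⟫`. -/
abbrev HilbertTensor (𝕜 H₁ H₂ : Type*) [RCLike 𝕜]
    [NormedAddCommGroup H₁] [InnerProductSpace 𝕜 H₁]
    [NormedAddCommGroup H₂] [InnerProductSpace 𝕜 H₂] :=
  UniformSpace.Completion (H₁ ⊗[𝕜] H₂)

namespace HilbertTensor

variable {𝕜 H₁ H₂ : Type*} [RCLike 𝕜]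
  [NormedAddCommGroup H₁] [InnerProductSpace 𝕜 H₁]
  [NormedAddCommGroup H₂] [InnerProductSpace 𝕜 H₂]

variable (𝕜) in
/-- The elementary tensor `a ⊗ b` as an element of the Hilbert space tensor product. -/
def elem (a : H₁) (b : H₂) : HilbertTensor 𝕜 H₁ H₂ :=
  ((a ⊗ₜ[𝕜] b : H₁ ⊗[𝕜] H₂) : UniformSpace.Completion (H₁ ⊗[𝕜] H₂))

/-- `u = ∑ₖ σₖ eₖ ⊗ fₖ` is a singular value decomposition of `u`, with singular values
`σ 0 ≥ σ 1 ≥ … ≥ 0`. Orthonormality of the singular vectors is required for the indices with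
`σ k ≠ 0` only, so that finite-dimensional spaces are covered (the other terms vanish). -/
structure IsSVD (u : HilbertTensor 𝕜 H₁ H₂) (σ : ℕ → ℝ) (e : ℕ → H₁) (f : ℕ → H₂) : Prop where
  antitone : Antitone σ
  nonneg : ∀ k, 0 ≤ σ k
  orthonormal_left : Orthonormal 𝕜 (fun k : {k : ℕ // σ k ≠ 0} => e k)
  orthonormal_right : Orthonormal 𝕜 (fun k : {k : ℕ // σ k ≠ 0} => f k)
  hasSum : HasSum (fun k => (σ k : 𝕜) • elem 𝕜 (e k) (f k)) u

/-- The rank of `u`: the smallest `r` such that the `(r+1)`-st singular value vanishes (this is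
`σ r`, as indices start at `0`), and `∞` if there is no such `r`. -/
def rank (u : HilbertTensor 𝕜 H₁ H₂) : ℕ∞ :=
  sInf {m : ℕ∞ | ∃ r : ℕ, m = r ∧ ∃ σ e f, IsSVD u σ e f ∧ σ r = 0}

/-- The error `τ_r(u)` of the best bilinear approximation of rank at most `r`. -/
def tau (r : ℕ) (u : HilbertTensor 𝕜 H₁ H₂) : ℝ :=
  ⨅ p : (Fin r → H₁) × (Fin r → H₂), ‖u - ∑ k, elem 𝕜 (p.1 k) (p.2 k)‖

/-- The sequence `uₙ₊₁ = Φ(uₙ)` generated from `u₀` satisfies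
`‖uₙ₊₁ - u‖ ≤ c qⁿ⁺¹ ‖u₀ - u‖` for all `n`. -/
def Contracts (Φ : HilbertTensor 𝕜 H₁ H₂ → HilbertTensor 𝕜 H₁ H₂) (u : HilbertTensor 𝕜 H₁ H₂)
    (c q : ℝ) (u₀ : HilbertTensor 𝕜 H₁ H₂) : Prop :=
  ∀ n : ℕ, ‖Φ^[n + 1] u₀ - u‖ ≤ c * q ^ (n + 1) * ‖u₀ - u‖

/-- The sequence `uₙ₊₁ = Φ(uₙ)` generated from `u₀` satisfies
`rank uₙ₊₁ ≤ R * rank uₙ` for all `n` (an inequality in `[0, ∞]`). -/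
def FiniteRankGrowth (Φ : HilbertTensor 𝕜 H₁ H₂ → HilbertTensor 𝕜 H₁ H₂)
    (R : ℝ) (u₀ : HilbertTensor 𝕜 H₁ H₂) : Prop :=
  ∀ n : ℕ, (rank (Φ^[n + 1] u₀) : ENNReal) ≤ ENNReal.ofReal R * (rank (Φ^[n] u₀) : ENNReal)

/-- `π₁(u)`, the distance of `u` to the elements of `D` of rank at most one. -/
def piOne (D : Set (HilbertTensor 𝕜 H₁ H₂)) (u : HilbertTensor 𝕜 H₁ H₂) : ℝ :=
  ⨅ v : {v : HilbertTensor 𝕜 H₁ H₂ // v ∈ D ∧ rank v ≤ 1},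
    ‖(v : HilbertTensor 𝕜 H₁ H₂) - u‖

end HilbertTensor

end

/-! The heart is that `tau r u ^ 2` is convex in `r`. With an SVD this is clear, since the
decrements are the decreasing `σ_k ^ 2`; here it comes from an exchange of one rank-one term
(`two_mul_tau_sq_le_norm`), so no SVD of `u` is needed. Started at rank at most one, the `n`-th
iterate has rank at most `⌊R ^ n⌋` and error at most `c q ^ n ‖v - u‖`. Convexity interpolates the
squared errors linearly between `R ^ l` and `R ^ (l + 1)`, where `l = ⌊log_R r⌋`; this gives the
square-root factor. The infimum over `v` then yields `piOne`. -/

namespace HilbertTensor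

/-! ### Convexity of the squared approximation error -/

section Convexity

variable {𝕜 H₁ H₂ : Type*} [RCLike 𝕜]
  [NormedAddCommGroup H₁] [InnerProductSpace 𝕜 H₁]
  [NormedAddCommGroup H₂] [InnerProductSpace 𝕜 H₂]

variable (𝕜 H₁ H₂) in
/-- The elementary tensor as a bilinear map. -/
noncomputable def elemBilin : H₁ →ₗ[𝕜] H₂ →ₗ[𝕜] HilbertTensor 𝕜 H₁ H₂ :=
  (TensorProduct.mk 𝕜 H₁ H₂).compr₂
    (UniformSpace.Completion.toComplL (𝕜 := 𝕜) (E := H₁ ⊗[𝕜] H₂)).toLinearMap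

lemma elemBilin_apply (a : H₁) (b : H₂) : elemBilin 𝕜 H₁ H₂ a b = elem 𝕜 a b := rfl

lemma inner_elem (a a' : H₁) (b b' : H₂) :
    inner 𝕜 (elem 𝕜 a b) (elem 𝕜 a' b') = inner 𝕜 a a' * inner 𝕜 b b' := by
  rw [elem, elem, UniformSpace.Completion.inner_coe, TensorProduct.inner_tmul]

lemma norm_elem (a : H₁) (b : H₂) : ‖elem 𝕜 a b‖ = ‖a‖ * ‖b‖ := by
  rw [elem, UniformSpace.Completion.norm_coe, TensorProduct.norm_tmul]

lemma tau_le (r : ℕ) (u : HilbertTensor 𝕜 H₁ H₂) (a : Fin r → H₁) (b : Fin r → H₂) :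
    tau r u ≤ ‖u - ∑ k, elem 𝕜 (a k) (b k)‖ :=
  ciInf_le (f := fun p : (Fin r → H₁) × (Fin r → H₂) => ‖u - ∑ k, elem 𝕜 (p.1 k) (p.2 k)‖)
    ⟨0, by rintro _ ⟨p, rfl⟩; exact norm_nonneg _⟩ (a, b)

lemma tau_nonneg (r : ℕ) (u : HilbertTensor 𝕜 H₁ H₂) : 0 ≤ tau r u :=
  Real.iInf_nonneg fun _ => norm_nonneg _

lemma tau_antitone (u : HilbertTensor 𝕜 H₁ H₂) : Antitone fun r => tau r u := by
  refine antitone_nat_of_succ_le fun n => le_ciInf fun p => ?_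
  refine (tau_le (n + 1) u (Fin.snoc p.1 0) (Fin.snoc p.2 0)).trans_eq ?_
  rw [Fin.sum_univ_castSucc]
  simp [← elemBilin_apply]

lemma le_sq_tau {x : ℝ} (r : ℕ) (u : HilbertTensor 𝕜 H₁ H₂)
    (h : ∀ (a : Fin r → H₁) (b : Fin r → H₂), x ≤ ‖u - ∑ k, elem 𝕜 (a k) (b k)‖ ^ 2) :
    x ≤ tau r u ^ 2 := by
  rw [← Real.sqrt_le_left (tau_nonneg r u)]
  exact le_ciInf fun p => (Real.sqrt_le_left (norm_nonneg _)).2 (h p.1 p.2)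

/-- If the left factors are linearly dependent, one term of the sum can be dropped. -/
lemma exists_sum_eq_of_dependent {n : ℕ} (a : Fin (n + 1) → H₁) (b : Fin (n + 1) → H₂)
    (α : Fin (n + 1) → 𝕜) (hα : α ≠ 0) (h : ∑ k, α k • a k = 0) :
    ∃ (a' : Fin n → H₁) (b' : Fin n → H₂),
      ∑ k, elem 𝕜 (a k) (b k) = ∑ k, elem 𝕜 (a' k) (b' k) := by
  obtain ⟨j, hj⟩ := Function.ne_iff.1 hα
  have hj : α j ≠ 0 := hj
  rw [Fin.sum_univ_succAbove _ j] at h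
  have ha : a j = ∑ k, (-(α j)⁻¹ * α (j.succAbove k)) • a (j.succAbove k) := by
    simp_rw [mul_smul, ← Finset.smul_sum]
    rw [← eq_neg_iff_add_eq_zero.2 h |> neg_eq_iff_eq_neg.2, smul_neg, neg_smul, neg_neg,
      smul_smul, inv_mul_cancel₀ hj, one_smul]
  refine ⟨fun k => a (j.succAbove k),
    fun k => b (j.succAbove k) + (-(α j)⁻¹ * α (j.succAbove k)) • b j, ?_⟩
  rw [Fin.sum_univ_succAbove _ j, ha]
  simp only [← elemBilin_apply, map_sum, map_smul, map_add, LinearMap.sum_apply,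
    LinearMap.smul_apply, Finset.sum_add_distrib]
  rw [add_comm]

/-- The isometry `b ↦ y ⊗ b` for a unit vector `y`. -/
noncomputable def leftIsometry (y : H₁) (hy : ‖y‖ = 1) : H₂ →ₗᵢ[𝕜] HilbertTensor 𝕜 H₁ H₂ where
  toLinearMap := elemBilin 𝕜 H₁ H₂ y
  norm_map' b := by rw [elemBilin_apply, norm_elem, hy, one_mul]

/-- Pythagoras: `J J*` is the orthogonal projection onto the range of `J`. -/
lemma norm_sq_eq_of_isometry {E F : Type*} [NormedAddCommGroup E] [InnerProductSpace 𝕜 E]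
    [CompleteSpace E] [NormedAddCommGroup F] [InnerProductSpace 𝕜 F] [CompleteSpace F]
    (J : E →ₗᵢ[𝕜] F) (x : F) (z : E) :
    ‖x - J z‖ ^ 2 = ‖x - J (J.toContinuousLinearMap.adjoint x)‖ ^ 2 +
      ‖J.toContinuousLinearMap.adjoint x - z‖ ^ 2 := by
  set p := J.toContinuousLinearMap.adjoint x with hp
  have horth : inner 𝕜 (x - J p) (J (p - z)) = 0 := by
    rw [inner_sub_left, J.inner_map_map, sub_eq_zero, hp, ContinuousLinearMap.adjoint_inner_left]
    rfl
  have h := norm_add_sq_eq_norm_sq_add_norm_sq_of_inner_eq_zero _ _ horth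
  rw [map_sub, sub_add_sub_cancel, ← map_sub, J.norm_map] at h
  simpa only [sq] using h

variable [CompleteSpace H₂]

lemma adjoint_leftIsometry_elem (y : H₁) (hy : ‖y‖ = 1) (a : H₁) (b : H₂) :
    (leftIsometry (𝕜 := 𝕜) (H₂ := H₂) y hy).toContinuousLinearMap.adjoint (elem 𝕜 a b) =
      inner 𝕜 y a • b := by
  refine ext_inner_left 𝕜 fun x => ?_
  rw [ContinuousLinearMap.adjoint_inner_right, inner_smul_right]
  exact inner_elem y a x b

/-- The exchange argument: approximations with `n` and `n + 2` terms can be traded for two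
approximations with `n + 1` terms, without increasing the sum of the squared errors. -/
lemma two_mul_tau_sq_le_norm (n : ℕ) (u : HilbertTensor 𝕜 H₁ H₂) (a : Fin n → H₁) (b : Fin n → H₂)
    (c : Fin (n + 2) → H₁) (d : Fin (n + 2) → H₂) :
    2 * tau (n + 1) u ^ 2 ≤
      ‖u - ∑ k, elem 𝕜 (a k) (b k)‖ ^ 2 + ‖u - ∑ k, elem 𝕜 (c k) (d k)‖ ^ 2 := by
  have sq_le {m : ℕ} {x : ℝ} (h : tau m u ≤ x) : tau m u ^ 2 ≤ x ^ 2 :=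
    pow_le_pow_left₀ (tau_nonneg m u) h 2
  -- These are `n` linear equations in `n + 2` unknowns.
  obtain ⟨α, hα0, hα⟩ : ∃ α : Fin (n + 2) → 𝕜, α ≠ 0 ∧
      ∀ i, inner 𝕜 (a i) (∑ k, α k • c k) = 0 := by
    let L : (Fin (n + 2) → 𝕜) →ₗ[𝕜] (Fin n → 𝕜) :=
      LinearMap.pi fun i => (innerₛₗ 𝕜 (a i)).comp (Fintype.linearCombination 𝕜 c)
    have hL : LinearMap.ker L ≠ ⊥ := LinearMap.ker_ne_bot_of_finrank_lt (by simp)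
    obtain ⟨α, hα, h0⟩ := Submodule.exists_mem_ne_zero_of_ne_bot hL
    exact ⟨α, h0, fun i => by
      simpa [L, Fintype.linearCombination_apply] using congrFun (LinearMap.mem_ker.1 hα) i⟩
  obtain hy | hy := eq_or_ne (∑ k, α k • c k) 0
  · obtain ⟨c', d', h⟩ := exists_sum_eq_of_dependent c d α hα0 hy
    rw [h, two_mul]
    exact add_le_add (sq_le ((tau_antitone u n.le_succ).trans (tau_le n u a b)))
      (sq_le (tau_le (n + 1) u c' d'))
  obtain ⟨y, hy1, β, hβ0, hβ, hya⟩ : ∃ y : H₁, ‖y‖ = 1 ∧ ∃ β : Fin (n + 2) → 𝕜, β ≠ 0 ∧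
      ∑ k, β k • c k = y ∧ ∀ i, inner 𝕜 y (a i) = 0 := by
    set y := ∑ k, α k • c k with hydef
    have ht : ((‖y‖⁻¹ : ℝ) : 𝕜) ≠ 0 := by simpa using hy
    refine ⟨((‖y‖⁻¹ : ℝ) : 𝕜) • y, by simp [norm_smul, hy], ((‖y‖⁻¹ : ℝ) : 𝕜) • α,
      smul_ne_zero ht hα0, ?_, fun i => ?_⟩
    · simp [hydef, Finset.smul_sum, mul_smul]
    · rw [inner_smul_left, inner_eq_zero_symm.1 (hα i), mul_zero]
  set J := leftIsometry (𝕜 := 𝕜) (H₂ := H₂) y hy1 with hJ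
  set Q := J.toContinuousLinearMap.adjoint with hQ
  have hJ_apply (x : H₂) : J x = elemBilin 𝕜 H₁ H₂ y x := rfl
  have hQv : Q (∑ k, elem 𝕜 (a k) (b k)) = 0 := by
    rw [map_sum]
    exact Finset.sum_eq_zero fun k _ => by rw [hQ, hJ, adjoint_leftIsometry_elem, hya, zero_smul]
  -- Since `y` is orthogonal to all `a i`, adding `y ⊗ Q u` gains exactly `‖Q u‖ ^ 2`.
  have hv : ‖u - (∑ k, elem 𝕜 (a k) (b k) + J (Q u))‖ ^ 2 + ‖Q u‖ ^ 2 =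
      ‖u - ∑ k, elem 𝕜 (a k) (b k)‖ ^ 2 := by
    have h := norm_sq_eq_of_isometry J (u - ∑ k, elem 𝕜 (a k) (b k)) 0
    rw [← hQ, map_sub Q, hQv] at h
    simpa [sub_sub] using h.symm
  -- Removing the `y`-component from the longer sum costs at most the same amount.
  have hw : ‖u - (∑ k, elem 𝕜 (c k) (d k) - J (Q (∑ k, elem 𝕜 (c k) (d k))))‖ ^ 2 ≤
      ‖u - ∑ k, elem 𝕜 (c k) (d k)‖ ^ 2 + ‖Q u‖ ^ 2 := by
    set w := ∑ k, elem 𝕜 (c k) (d k)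
    have h := norm_sq_eq_of_isometry J (u - w) (- Q w)
    have h' := norm_sq_eq_of_isometry J (u - w) 0
    rw [← hQ, map_neg, map_sub Q, sub_neg_eq_add, sub_neg_eq_add, sub_add_cancel] at h
    rw [← hQ, map_zero, sub_zero, map_sub Q] at h'
    have e : u - (w - J (Q w)) = u - w + J (Q w) := by abel
    rw [e, h, h']
    have := sq_nonneg ‖Q u - Q w - 0‖
    linarith
  have hv' : tau (n + 1) u ^ 2 ≤ ‖u - (∑ k, elem 𝕜 (a k) (b k) + J (Q u))‖ ^ 2 := by
    refine sq_le ((tau_le (n + 1) u (Fin.snoc a y) (Fin.snoc b (Q u))).trans_eq ?_)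
    rw [Fin.sum_univ_castSucc]
    simp [← elemBilin_apply, hJ_apply]
  have hw' : tau (n + 1) u ^ 2 ≤
      ‖u - (∑ k, elem 𝕜 (c k) (d k) - J (Q (∑ k, elem 𝕜 (c k) (d k))))‖ ^ 2 := by
    have e : ∑ k, elem 𝕜 (c k) (d k) - J (Q (∑ k, elem 𝕜 (c k) (d k))) =
        ∑ k, elem 𝕜 (c k - inner 𝕜 y (c k) • y) (d k) := by
      simp only [map_sum, ← Finset.sum_sub_distrib]
      refine Finset.sum_congr rfl fun k _ => ?_
      rw [hQ, hJ, adjoint_leftIsometry_elem, ← hJ, hJ_apply]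
      simp [← elemBilin_apply]
    -- As `y` lies in the span of the `c k`, projecting them off `y` makes them dependent, so a term
    -- drops out.
    have h0 : ∑ k, β k • (c k - inner 𝕜 y (c k) • y) = 0 := by
      have h1 : ∑ k, β k * inner 𝕜 y (c k) = 1 := by
        have : inner 𝕜 y (∑ k, β k • c k) = (1 : 𝕜) := by
          rw [hβ, inner_self_eq_norm_sq_to_K, hy1]; simp
        simpa [inner_sum, inner_smul_right] using this
      simp_rw [smul_sub, smul_smul, Finset.sum_sub_distrib, ← Finset.sum_smul, h1, hβ, one_smul,
        sub_self]
    obtain ⟨c', d', h⟩ := exists_sum_eq_of_dependent _ d β hβ0 h0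
    rw [e, h]
    exact sq_le (tau_le (n + 1) u c' d')
  linarith

lemma two_mul_tau_sq_le (n : ℕ) (u : HilbertTensor 𝕜 H₁ H₂) :
    2 * tau (n + 1) u ^ 2 ≤ tau n u ^ 2 + tau (n + 2) u ^ 2 := by
  rw [← sub_le_iff_le_add]
  refine le_sq_tau n u fun a b => ?_
  rw [sub_le_comm]
  refine le_sq_tau (n + 2) u fun c d => ?_
  linarith [two_mul_tau_sq_le_norm n u a b c d]

end Convexity

/-! ### Ranks of the iterates -/

section Rank

variable {𝕜 H₁ H₂ : Type*} [RCLike 𝕜]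
  [NormedAddCommGroup H₁] [InnerProductSpace 𝕜 H₁]
  [NormedAddCommGroup H₂] [InnerProductSpace 𝕜 H₂]

lemma tau_le_of_rank_le {m : ℕ} (u v : HilbertTensor 𝕜 H₁ H₂) (hv : rank v ≤ m) :
    tau m u ≤ ‖v - u‖ := by
  have hne : {m : ℕ∞ | ∃ r : ℕ, m = r ∧ ∃ σ e f, IsSVD v σ e f ∧ σ r = 0}.Nonempty := by
    by_contra h
    rw [Set.not_nonempty_iff_eq_empty] at h
    rw [rank, h, sInf_empty, top_le_iff] at hv
    exact ENat.natCast_ne_top m hv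
  obtain ⟨k, hk, σ, e, f, hsvd, hσ⟩ := csInf_mem hne
  have hkm : k ≤ m := by
    rw [rank, hk] at hv
    exact_mod_cast hv
  have hzero (i : ℕ) (hi : i ∉ Finset.range k) : (σ i : 𝕜) • elem 𝕜 (e i) (f i) = 0 := by
    have : σ i = 0 := le_antisymm
      ((hsvd.antitone (not_lt.1 (Finset.mem_range.not.1 hi))).trans_eq hσ) (hsvd.nonneg i)
    simp [this]
  have hsum : v = ∑ i : Fin k, elem 𝕜 ((σ i : 𝕜) • e i) (f i) := by
    rw [hsvd.hasSum.unique (hasSum_sum_of_ne_finset_zero hzero), Finset.sum_range]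
    simp [← elemBilin_apply]
  calc tau m u ≤ tau k u := tau_antitone u hkm
    _ ≤ ‖u - v‖ := by rw [hsum]; exact tau_le k u _ _
    _ = ‖v - u‖ := norm_sub_rev _ _

lemma rank_iterate_le {Φ : HilbertTensor 𝕜 H₁ H₂ → HilbertTensor 𝕜 H₁ H₂} {R : ℝ} (hR : 0 ≤ R)
    {u₀ : HilbertTensor 𝕜 H₁ H₂} (h : FiniteRankGrowth Φ R u₀) (h0 : rank u₀ ≤ 1) (n : ℕ) :
    rank (Φ^[n] u₀) ≤ (⌊R ^ n⌋₊ : ℕ) := by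
  have key : (rank (Φ^[n] u₀) : ENNReal) ≤ ENNReal.ofReal (R ^ n) := by
    induction n with
    | zero => simpa using (ENat.toENNReal_le (n := 1)).2 h0
    | succ n ih =>
      refine (h n).trans ?_
      rw [pow_succ', ENNReal.ofReal_mul hR]
      gcongr
  have hfin : rank (Φ^[n] u₀) ≠ ⊤ := by
    rintro h
    rw [h] at key
    simp at key
  obtain ⟨k, hk⟩ := ENat.ne_top_iff_exists.1 hfin
  rw [← hk] at key ⊢
  rw [ENat.toENNReal_coe, ← ENNReal.ofReal_natCast,
    ENNReal.ofReal_le_ofReal_iff (by positivity)] at key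
  exact_mod_cast Nat.le_floor key

end Rank

/-! ### Interpolation of convex sequences -/

/-- A convex sequence lies above each of its right supporting lines. -/
lemma supporting_line_le {f : ℕ → ℝ} (hf : ∀ n, 2 * f (n + 1) ≤ f n + f (n + 2)) (r n : ℕ) :
    f r - ((n : ℝ) - r) * (f r - f (r + 1)) ≤ f n := by
  have hanti : Antitone fun n => f n - f (n + 1) :=
    antitone_nat_of_succ_le fun n => by linarith [hf n]
  obtain hrn | hnr := le_total r n
  · induction n, hrn using Nat.le_induction with
    | base => simp
    | succ n hn ih =>
      have : f n - f (n + 1) ≤ f r - f (r + 1) := hanti hn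
      push_cast
      linarith
  · induction hnr using Nat.decreasingInduction with
    | self => simp
    | of_succ n hn ih =>
      have : f r - f (r + 1) ≤ f n - f (n + 1) := hanti hn.le
      push_cast at ih
      linarith

lemma le_interpolation {f : ℕ → ℝ} (hf : ∀ n, 2 * f (n + 1) ≤ f n + f (n + 2))
    (hanti : Antitone f) {x y A B : ℝ} (hx : 0 ≤ x) {r : ℕ} (hxr : x ≤ r) (hry : r < y)
    (hA : f ⌊x⌋₊ ≤ A) (hB : f ⌊y⌋₊ ≤ B) :
    (y - x) * f r ≤ (y - r) * A + (r - x) * B := by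
  have hd : 0 ≤ f r - f (r + 1) := sub_nonneg.2 (hanti r.le_succ)
  have hy : 0 ≤ y := r.cast_nonneg.trans hry.le
  have h1 := supporting_line_le hf r ⌊x⌋₊
  have h2 := supporting_line_le hf r ⌊y⌋₊
  -- The supporting line at `r` is nonincreasing, so rounding `x` down only raises it: real nodes
  -- are allowed.
  have hA' : f r + (r - x) * (f r - f (r + 1)) ≤ A := by
    nlinarith [mul_le_mul_of_nonneg_right (Nat.floor_le hx) hd]
  have hB' : f r - (y - r) * (f r - f (r + 1)) ≤ B := by
    nlinarith [mul_le_mul_of_nonneg_right (Nat.floor_le hy) hd]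
  have := mul_le_mul_of_nonneg_left hA' (sub_nonneg.2 hry.le)
  have := mul_le_mul_of_nonneg_left hB' (sub_nonneg.2 hxr)
  linarith

lemma rpow_logb_eq {q R r : ℝ} (hq₀ : 0 < q) (hq₁ : q < 1) (hR : 1 < R) (hr : 0 < r) :
    q ^ Real.logb R r = (1 / r) ^ |Real.log q / Real.log R| := by
  rw [abs_of_neg (div_neg_of_neg_of_pos (Real.log_neg hq₀ hq₁) (Real.log_pos hR)),
    Real.rpow_def_of_pos hq₀, Real.rpow_def_of_pos (by positivity), one_div, Real.log_inv,
    Real.logb]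
  ring_nf

end HilbertTensor

/-! ### The main estimate -/

open HilbertTensor in
theorem theorem1 {𝕜 H₁ H₂ : Type*} [RCLike 𝕜]
    [NormedAddCommGroup H₁] [InnerProductSpace 𝕜 H₁] [CompleteSpace H₁]
    [NormedAddCommGroup H₂] [InnerProductSpace 𝕜 H₂] [CompleteSpace H₂]
    (u : HilbertTensor 𝕜 H₁ H₂)
    (Φ : HilbertTensor 𝕜 H₁ H₂ → HilbertTensor 𝕜 H₁ H₂)
    (c q R : ℝ) (hc : 0 < c) (hq₀ : 0 < q) (hq₁ : q < 1) (hR : 1 < R)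
    (D : Set (HilbertTensor 𝕜 H₁ H₂))
    (hD : D ⊆ {u₀ | HilbertTensor.Contracts Φ u c q u₀ ∧ HilbertTensor.FiniteRankGrowth Φ R u₀})
    (hA0 : (D ∩ {u₀ | HilbertTensor.rank u₀ ≤ 1}).Nonempty)
    (r : ℕ) (hr : 1 ≤ r) (hcr : 1 ≤ c ∨ R ≤ r) :
    HilbertTensor.tau r u ≤
        c * HilbertTensor.piOne D u *
          √(1 - (1 - q ^ 2) * ((r : ℝ) - R ^ ⌊Real.logb R r⌋) / ((R - 1) * R ^ ⌊Real.logb R r⌋)) *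
          q ^ ⌊Real.logb R r⌋ ∧
      HilbertTensor.tau r u ≤ c * HilbertTensor.piOne D u * q ^ ⌊Real.logb R r⌋ ∧
      c * HilbertTensor.piOne D u * q ^ ⌊Real.logb R r⌋ ≤
        c * HilbertTensor.piOne D u * q ^ (Real.logb R r - 1) ∧
      c * HilbertTensor.piOne D u * q ^ (Real.logb R r - 1) =
        c * HilbertTensor.piOne D u * q⁻¹ * (1 / (r : ℝ)) ^ |Real.log q / Real.log R| := by
  have hr0 : (0 : ℝ) < r := by exact_mod_cast hr
  have hR0 : 0 < R := one_pos.trans hR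
  have hlog : 0 ≤ Real.logb R r := Real.logb_nonneg hR (by exact_mod_cast hr)
  have hpi : 0 ≤ piOne D u := Real.iInf_nonneg fun _ => norm_nonneg _
  have hcpi : 0 ≤ c * piOne D u := by positivity
  have hfloor : q ^ ⌊Real.logb R r⌋ ≤ q ^ (Real.logb R r - 1) := by
    rw [← Real.rpow_intCast]
    exact Real.rpow_le_rpow_of_exponent_ge hq₀ hq₁.le (Int.sub_one_lt_floor _).le
  obtain ⟨l, hl⟩ := Int.eq_ofNat_of_zero_le (Int.floor_nonneg.2 hlog)
  have hl : ⌊Real.logb R r⌋ = (l : ℤ) := hl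
  obtain ⟨hl₁, hl₂⟩ := Int.floor_eq_iff.1 hl
  have hRl : R ^ l ≤ r := by
    rw [← Real.rpow_natCast]
    exact (Real.le_logb_iff_rpow_le hR hr0).1 (by exact_mod_cast hl₁)
  have hrR : (r : ℝ) < R ^ (l + 1) := by
    rw [← Real.rpow_natCast]
    exact (Real.logb_lt_iff_lt_rpow hR hr0).1 (by exact_mod_cast hl₂)
  have hden : 0 < (R - 1) * R ^ l := mul_pos (sub_pos.2 hR) (by positivity)
  have hq2 : 0 ≤ 1 - q ^ 2 := by nlinarith
  rw [hl, zpow_natCast] at hfloor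
  rw [hl, zpow_natCast, zpow_natCast]
  set s := 1 - (1 - q ^ 2) * ((r : ℝ) - R ^ l) / ((R - 1) * R ^ l) with hs
  have hs1 : √s ≤ 1 := by
    rw [Real.sqrt_le_one, hs, sub_le_self_iff]
    exact div_nonneg (mul_nonneg hq2 (sub_nonneg.2 hRl)) hden.le
  have main : tau r u ≤ c * piOne D u * √s * q ^ l := by
    have hK : 0 ≤ c * √s * q ^ l := by positivity
    obtain ⟨v₀, hv₀, hv₀'⟩ := hA0
    have : Nonempty {v : HilbertTensor 𝕜 H₁ H₂ // v ∈ D ∧ rank v ≤ 1} := ⟨v₀, hv₀, hv₀'⟩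
    rw [show c * piOne D u * √s * q ^ l = c * √s * q ^ l * piOne D u by ring, piOne,
      Real.mul_iInf_of_nonneg hK]
    refine le_ciInf fun ⟨v, hvD, hv⟩ => ?_
    obtain ⟨hcontr, hgrow⟩ := hD hvD
    have herr (n : ℕ) (hn : 1 ≤ c ∨ n ≠ 0) : ‖Φ^[n] v - u‖ ≤ c * q ^ n * ‖v - u‖ := by
      cases n with
      | zero =>
        have hc1 : 1 ≤ c := hn.resolve_right (by simp)
        simpa using le_mul_of_one_le_left (norm_nonneg (v - u)) hc1
      | succ n => exact hcontr n
    -- The error bound at the starting point needs `1 ≤ c`; it is used only if `l = 0`, that is, `r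
    -- < R`.
    have hl0 : 1 ≤ c ∨ l ≠ 0 := by
      refine hcr.imp_right fun h => ?_
      rintro rfl
      simp only [zero_add, pow_one] at hrR
      exact hrR.not_ge h
    have htau (n : ℕ) (hn : 1 ≤ c ∨ n ≠ 0) :
        tau ⌊R ^ n⌋₊ u ^ 2 ≤ (c * q ^ n * ‖v - u‖) ^ 2 :=
      pow_le_pow_left₀ (tau_nonneg _ _)
        ((tau_le_of_rank_le u _ (rank_iterate_le hR0.le hgrow hv n)).trans (herr n hn)) 2
    have hint := le_interpolation (f := fun n => tau n u ^ 2) (two_mul_tau_sq_le · u)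
      (fun m n hmn => pow_le_pow_left₀ (tau_nonneg _ _) (tau_antitone u hmn) 2)
      (by positivity) hRl hrR (htau l hl0) (htau (l + 1) (Or.inr l.succ_ne_zero))
    -- `s` is the interpolation at `r` between `1` at `R ^ l` and `q ^ 2` at `R ^ (l + 1)`.
    have hsq : tau r u ^ 2 ≤ s * (c * q ^ l * ‖v - u‖) ^ 2 := by
      refine le_of_mul_le_mul_left (hint.trans_eq ?_)
        (show 0 < R ^ (l + 1) - R ^ l from sub_pos.2 (hRl.trans_lt hrR))
      have : R - 1 ≠ 0 := (sub_pos.2 hR).ne'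
      rw [hs]
      field_simp
      ring
    calc tau r u ≤ √(s * (c * q ^ l * ‖v - u‖) ^ 2) := Real.le_sqrt_of_sq_le hsq
      _ = c * √s * q ^ l * ‖v - u‖ := by
        rw [Real.sqrt_mul' _ (sq_nonneg _), Real.sqrt_sq (by positivity)]
        ring
  refine ⟨main, main.trans ?_, mul_le_mul_of_nonneg_left hfloor hcpi, ?_⟩
  · exact mul_le_mul_of_nonneg_right (mul_le_of_le_one_right hcpi hs1) (by positivity)
  · rw [Real.rpow_sub_one hq₀.ne', rpow_logb_eq hq₀ hq₁ hR hr0]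
    ring
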